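/- For a set $P\subseteq\mathbb{R}^2$ let $\underline\delta(P)=\liminf_{r\to\infty}\frac{|P\cap D_r|}{\operatorname{Area}(D_r)}\in[0,\infty]$, where $D_r$ is the disk of radius $r$ centered at the origin. For $w,h\ge 1$ let $R_{w\times 1}$ and $R_{1\times h}$ be closed axis-parallel rectangles (width $\times$ height). Call $P$ $(w,h)$-piercing if it intersects every translate of $R_{w\times 1}$ and every translate of $R_{1\times h}$. Let $A_T(w,h)=1/\pi_T$ and $A_L(w,h)=1/\pi_L$, where $\pi_T$ is the infimum of $\underline\delta(P)$ over all $(w,h)$-piercing point sets $P$, and $\pi_L$ is the infimum of $\underline\delta(P)$ over all $(w,h)$-piercing (full-rank) lattices $P$. (Thus $A_T$ and $A_L$ are the largest possible per-point areas of a $(w,h)$-piercing point set and lattice, respectively.) Theorem. Fix real numbers $w,h\ge 1$. (i) If $\lfloor w\rfloor\neq\lfloor h\rfloor$, then $A_T(w,h)=A_L(w,h)=\min\{w,h\}$. (ii) If $\lfloor w\rfloor=\lfloor h\rfloor=k$ (so $k\ge 1$), write $w=k+x$ and $h=k+y$ with $x,y\in[0,1)$. Then $$\max\left\{k,\; k+xy-\frac{k-1}{k}(1-x)(1-y)\right\}\le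 A_L(w,h)\le A_T(w,h)\le k+xy.$$ The outer lower and upper bounds here coincide exactly when $k=1$ or when $w$ or $h$ is an integer (that is, $x=0$ or $y=0$). If $k=1$, then $A_L(w,h)=A_T(w,h)=k+xy$; if $w$ or $h$ is an integer, then $A_L(w,h)=A_T(w,h)=\min\{w,h\}=k$. -/

import Mathlib

open Filter MeasureTheory
open scoped ENNReal Pointwise

noncomputable section

/-- The Euclidean plane. -/
abbrev Plane : Type := EuclideanSpace ℝ (Fin 2)

/-- The closed axis-parallel rectangle `[0, w] × [0, h]` of width `w` and height `h`. -/
def rect (w h : ℝ) : Set Plane :=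
  {p | 0 ≤ p 0 ∧ p 0 ≤ w ∧ 0 ≤ p 1 ∧ p 1 ≤ h}

/-- `P` intersects every translate `x + S` of every member `S` of the family `F`. -/
def IsPiercing (F : Set (Set Plane)) (P : Set Plane) : Prop :=
  ∀ S ∈ F, ∀ x : Plane, ∃ p ∈ P, p ∈ x +ᵥ S

/-- `P` is a (full-rank) lattice in the plane: a discrete subgroup spanning the plane over `ℝ`. -/
def IsPlaneLattice (P : Set Plane) : Prop :=
  ∃ (L : Submodule ℤ Plane) (_ : DiscreteTopology L), IsZLattice ℝ L ∧ P = (L : Set Plane)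

/-- The density `|P ∩ D| / Area D` of `P` over `D`; it is `∞` if `P ∩ D` is infinite and `D` has
finite area. -/
def densityOver (P D : Set Plane) : ℝ≥0∞ :=
  ((P ∩ D).encard : ℝ≥0∞) / volume D

/-- The asymptotic lower density: the lower limit, as `r → ∞`, of the density over the disk of
radius `r` centered at the origin. -/
def lowerDensity (P : Set Plane) : ℝ≥0∞ :=
  liminf (fun r : ℝ => densityOver P (Metric.closedBall (0 : Plane) r)) atTop

/-- The translative piercing density of a family of shapes. -/
def piercingDensity (F : Set (Set Plane)) : ℝ≥0∞ :=
  ⨅ (P : Set Plane) (_ : IsPiercing F P), lowerDensity P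

/-- The translative lattice piercing density of a family of shapes. -/
def latticePiercingDensity (F : Set (Set Plane)) : ℝ≥0∞ :=
  ⨅ (P : Set Plane) (_ : IsPlaneLattice P) (_ : IsPiercing F P), lowerDensity P

/-- The family consisting of the `w × 1` rectangle and the `1 × h` rectangle. -/
def rectPair (w h : ℝ) : Set (Set Plane) :=
  {rect w 1, rect 1 h}

/-- The largest possible per-point area of a point set piercing all translates of the
`w × 1` and `1 × h` rectangles. -/
def areaT (w h : ℝ) : ℝ≥0∞ :=
  (piercingDensity (rectPair w h))⁻¹

/-- The largest possible per-point area of a lattice piercing all translates of the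
`w × 1` and `1 × h` rectangles. -/
def areaL (w h : ℝ) : ℝ≥0∞ :=
  (latticePiercingDensity (rectPair w h))⁻¹

end

/-! Upper bounds. A piercing set meets every translate of a rectangle of area `w` and of one of area
`h`, so its density is at least `1 / min w h`. If `w = k + x` and `h = k + y`, consider the
horizontal strip of height `k` at height `t`. It is a stack of `k` unit rows, so each of its windows
of length `k + x` holds at least `k` points. Sweep along the strip: if the next point is at distance
at most 1, advance to it; otherwise advance by `k + x`, gaining `k` points and one long gap. Hence
length is at most the number of points plus `x` times the number of long gaps
(`length_le_ncard_add`).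

Now vary `t`. A point lies in the strip for a set of `t` of measure `k`. It ends a long gap only for
`t` in an interval of length `y`, because the `1 × (k + y)` rectangle to its left is pierced
(`exists_Icc_of_mem_afterLongGap`). Integration over `t` charges each point at most `k + x * y`
(`mul_le_mul_ncard_box`).

Lower bounds. The lattice spanned by `(1, c)` and `(u, -1)`, with `0 ≤ c ≤ 1` and `u ≥ 0`, has
covolume `1 + u * c`. It pierces when `u + 1 ≤ w` and `K * c + 1 ≤ h` for some integer `K ≥ u`
(`ofReal_le_areaL`). All lattice bounds are choices of `u`, `c`, `K`, up to exchanging the axes. -/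

/-! ### Lattice cells and asymptotic density -/

/-- The half-open cell at `v` of the tiling by translates of the fundamental domain of `b`. -/
def latticeCell (b : Module.Basis (Fin 2) ℝ Plane) (v : Plane) : Set Plane :=
  {z | z - v ∈ ZSpan.fundamentalDomain b}

theorem latticeCell_eq_preimage (b : Module.Basis (Fin 2) ℝ Plane) (v : Plane) :
    latticeCell b v = (fun z => z - v) ⁻¹' ZSpan.fundamentalDomain b := rfl

theorem measurableSet_latticeCell (b : Module.Basis (Fin 2) ℝ Plane) (v : Plane) :
    MeasurableSet (latticeCell b v) :=
  (measurable_id.sub_const v) (ZSpan.fundamentalDomain_measurableSet b)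

theorem volume_latticeCell (b : Module.Basis (Fin 2) ℝ Plane) (v : Plane) :
    volume (latticeCell b v) = volume (ZSpan.fundamentalDomain b) := by
  simp_rw [latticeCell_eq_preimage, sub_eq_add_neg]
  exact measure_preimage_add_right _ _ _

theorem eq_floor_of_mem_latticeCell (b : Module.Basis (Fin 2) ℝ Plane) {v z : Plane}
    (hv : v ∈ Submodule.span ℤ (Set.range b)) (hz : z ∈ latticeCell b v) :
    v = (ZSpan.floor b z : Plane) := by
  have h := (ZSpan.vadd_mem_fundamentalDomain b (-⟨v, hv⟩) z).1 (by
    change -v + z ∈ _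
    rw [neg_add_eq_sub]
    exact hz)
  exact congrArg Subtype.val (neg_injective h)

theorem mem_latticeCell_floor (b : Module.Basis (Fin 2) ℝ Plane) (z : Plane) :
    z ∈ latticeCell b (ZSpan.floor b z : Plane) :=
  ZSpan.fract_mem_fundamentalDomain b z

theorem disjoint_latticeCell (b : Module.Basis (Fin 2) ℝ Plane) {v v' : Plane}
    (hv : v ∈ Submodule.span ℤ (Set.range b)) (hv' : v' ∈ Submodule.span ℤ (Set.range b))
    (hne : v ≠ v') : Disjoint (latticeCell b v) (latticeCell b v') :=
  Set.disjoint_left.2 fun _ hz hz' => hne <|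
    (eq_floor_of_mem_latticeCell b hv hz).trans (eq_floor_of_mem_latticeCell b hv' hz').symm

theorem volume_fundamentalDomain_plane (b : Module.Basis (Fin 2) ℝ Plane) :
    volume (ZSpan.fundamentalDomain b) =
      ENNReal.ofReal |b 0 0 * b 1 1 - b 0 1 * b 1 0| := by
  rw [ZSpan.measure_fundamentalDomain b volume (EuclideanSpace.basisFun (Fin 2) ℝ).toBasis,
    measure_congr (ZSpan.fundamentalDomain_ae_parallelepiped _ volume)]
  have h1 : volume (parallelepiped ⇑(EuclideanSpace.basisFun (Fin 2) ℝ).toBasis) = 1 := by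
    simpa using (EuclideanSpace.basisFun (Fin 2) ℝ).volume_parallelepiped
  rw [h1, mul_one, Module.Basis.det_apply, Matrix.det_fin_two]
  congr 2
  simp [Module.Basis.toMatrix_apply]
  ring

theorem volume_fundamentalDomain_pos (b : Module.Basis (Fin 2) ℝ Plane) :
    volume (ZSpan.fundamentalDomain b) ≠ 0 := ZSpan.measure_fundamentalDomain_ne_zero b

theorem volume_fundamentalDomain_ne_top (b : Module.Basis (Fin 2) ℝ Plane) :
    volume (ZSpan.fundamentalDomain b) ≠ ⊤ :=
  (ZSpan.fundamentalDomain_isBounded b).measure_lt_top.ne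

theorem exists_norm_le_fundamentalDomain (b : Module.Basis (Fin 2) ℝ Plane) :
    ∃ c : ℝ, 0 < c ∧ ∀ z ∈ ZSpan.fundamentalDomain b, ‖z‖ ≤ c := by
  obtain ⟨c, hc, h⟩ := (ZSpan.fundamentalDomain_isBounded b).exists_pos_norm_le
  exact ⟨c, hc, h⟩

theorem volume_closedBall_plane {r : ℝ} (hr : 0 ≤ r) :
    volume (Metric.closedBall (0 : Plane) r) =
      ENNReal.ofReal (r ^ 2) * volume (Metric.closedBall (0 : Plane) 1) := by
  have := Measure.addHaar_closedBall' (volume : Measure Plane) 0 hr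
  simpa using this

theorem volume_closedBall_one_ne_zero : volume (Metric.closedBall (0 : Plane) 1) ≠ 0 :=
  (Metric.measure_closedBall_pos _ _ one_pos).ne'

theorem volume_closedBall_one_ne_top : volume (Metric.closedBall (0 : Plane) 1) ≠ ⊤ :=
  measure_closedBall_lt_top.ne

theorem volume_closedBall_div {r s : ℝ} (hr : 0 < r) (hs : 0 ≤ s) :
    volume (Metric.closedBall (0 : Plane) s) / volume (Metric.closedBall (0 : Plane) r) =
      ENNReal.ofReal ((s / r) ^ 2) := by
  rw [volume_closedBall_plane hr.le, volume_closedBall_plane hs,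
    ENNReal.mul_div_mul_right _ _ volume_closedBall_one_ne_zero volume_closedBall_one_ne_top,
    ← ENNReal.ofReal_div_of_pos (by positivity), div_pow]

theorem tendsto_ofReal_ratio_sq (c : ℝ) :
    Tendsto (fun r : ℝ => ENNReal.ofReal (((r + c) / r) ^ 2)) atTop (nhds 1) := by
  have h : Tendsto (fun r : ℝ => (1 + c * r⁻¹) ^ 2) atTop (nhds 1) := by
    have := ((tendsto_inv_atTop_zero (𝕜 := ℝ)).const_mul c).const_add 1
    simpa using this.pow 2
  have h2 : Tendsto (fun r : ℝ => ((r + c) / r) ^ 2) atTop (nhds 1) := by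
    refine h.congr' ?_
    filter_upwards [eventually_gt_atTop 0] with r hr
    field_simp
  simpa using ENNReal.tendsto_ofReal h2

/-- The lattice points at distance at most `r` from the origin. -/
noncomputable def latticePointsInBall (b : Module.Basis (Fin 2) ℝ Plane) (r : ℝ) : Finset Plane :=
  (ZSpan.setFinite_inter b (Metric.isBounded_closedBall (x := (0 : Plane)) (r := r))).toFinset

theorem mem_latticePointsInBall {b : Module.Basis (Fin 2) ℝ Plane} {r : ℝ} {v : Plane} :
    v ∈ latticePointsInBall b r ↔ ‖v‖ ≤ r ∧ v ∈ Submodule.span ℤ (Set.range b) := by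
  simp [latticePointsInBall]

theorem encard_inter_biUnion_latticeCell (b : Module.Basis (Fin 2) ℝ Plane) (P : Set Plane) (m : ℕ)
    (h : ∀ v, (m : ℕ∞) ≤ (P ∩ latticeCell b v).encard) (J : Finset Plane)
    (hJ : ∀ v ∈ J, v ∈ Submodule.span ℤ (Set.range b)) :
    ((J.card * m : ℕ) : ℕ∞) ≤ (P ∩ ⋃ v ∈ J, latticeCell b v).encard := by
  classical
  induction J using Finset.induction_on with
  | empty => simp
  | insert v J hv ih =>
    rw [Finset.card_insert_of_notMem hv, Finset.set_biUnion_insert, Set.inter_union_distrib_left,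
      Set.encard_union_eq, add_mul, one_mul, add_comm]
    · push_cast
      gcongr
      · exact h v
      · exact_mod_cast ih fun u hu => hJ u (Finset.mem_insert_of_mem hu)
    · refine Set.disjoint_left.2 fun z hz hz' => ?_
      obtain ⟨u, hu, hzu⟩ := Set.mem_iUnion₂.1 hz'.2
      exact Set.disjoint_left.1 (disjoint_latticeCell b (hJ v (Finset.mem_insert_self _ _))
        (hJ u (Finset.mem_insert_of_mem hu)) (by rintro rfl; exact hv hu)) hz.2 hzu

theorem latticeCell_subset_closedBall {b : Module.Basis (Fin 2) ℝ Plane} {c r : ℝ}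
    (hc : ∀ z ∈ ZSpan.fundamentalDomain b, ‖z‖ ≤ c) {v : Plane} (hv : ‖v‖ ≤ r) :
    latticeCell b v ⊆ Metric.closedBall 0 (r + c) := by
  intro z hz
  have := norm_add_le v (z - v)
  rw [add_sub_cancel] at this
  have h2 := hc _ hz
  simp only [mem_closedBall_zero_iff]
  linarith

theorem closedBall_subset_biUnion_latticeCell {b : Module.Basis (Fin 2) ℝ Plane} {c r : ℝ}
    (hc : ∀ z ∈ ZSpan.fundamentalDomain b, ‖z‖ ≤ c) :
    Metric.closedBall 0 (r - c) ⊆ ⋃ v ∈ latticePointsInBall b r, latticeCell b v := by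
  intro z hz
  refine Set.mem_iUnion₂.2 ⟨ZSpan.floor b z, ?_, mem_latticeCell_floor b z⟩
  refine mem_latticePointsInBall.2 ⟨?_, (ZSpan.floor b z).2⟩
  have h1 := hc _ (mem_latticeCell_floor b z)
  have h2 := norm_sub_le z (z - (ZSpan.floor b z : Plane))
  rw [sub_sub_cancel] at h2
  rw [mem_closedBall_zero_iff] at hz
  linarith

theorem volume_biUnion_latticeCell (b : Module.Basis (Fin 2) ℝ Plane) (r : ℝ) :
    volume (⋃ v ∈ latticePointsInBall b r, latticeCell b v) =
      (latticePointsInBall b r).card * volume (ZSpan.fundamentalDomain b) := by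
  rw [measure_biUnion_finset _ fun v _ => measurableSet_latticeCell b v]
  · simp [volume_latticeCell]
  · intro u hu v hv huv
    exact disjoint_latticeCell b (mem_latticePointsInBall.1 hu).2 (mem_latticePointsInBall.1 hv).2
      huv

/-- If every translate of a fundamental domain contains at least `m` points of `P`, then `P` has
lower density at least `m` per area of the domain. -/
theorem div_volume_le_lowerDensity (b : Module.Basis (Fin 2) ℝ Plane) (P : Set Plane) (m : ℕ)
    (h : ∀ v, (m : ℕ∞) ≤ (P ∩ latticeCell b v).encard) :
    (m : ℝ≥0∞) / volume (ZSpan.fundamentalDomain b) ≤ lowerDensity P := by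
  obtain ⟨c, hc0, hc⟩ := exists_norm_le_fundamentalDomain b
  set A := volume (ZSpan.fundamentalDomain b) with hA
  have hA0 : A ≠ 0 := volume_fundamentalDomain_pos b
  have hAt : A ≠ ⊤ := volume_fundamentalDomain_ne_top b
  -- The cells based in the disk of radius `r - c` cover the disk of radius `r - 2 * c` and stay
  -- inside the disk of radius `r`.
  have hlim : Tendsto (fun r : ℝ => (m : ℝ≥0∞) / A * ENNReal.ofReal (((r + -(2 * c)) / r) ^ 2))
      atTop (nhds (m / A)) := by
    have := ENNReal.Tendsto.const_mul (a := (m : ℝ≥0∞) / A) (tendsto_ofReal_ratio_sq (-(2 * c)))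
      (Or.inl one_ne_zero)
    simpa using this
  rw [← hlim.liminf_eq]
  refine liminf_le_liminf ?_
  filter_upwards [eventually_gt_atTop (2 * c)] with r hr
  have hr0 : 0 < r := by linarith
  rw [← volume_closedBall_div hr0 (by linarith), densityOver, ← mul_div_assoc]
  gcongr
  have h1 : volume (Metric.closedBall (0 : Plane) (r + -(2 * c))) ≤
      (latticePointsInBall b (r - c)).card * A := by
    rw [← volume_biUnion_latticeCell]
    refine measure_mono ?_
    convert closedBall_subset_biUnion_latticeCell (b := b) (r := r - c) hc using 2
    ring
  calc (m : ℝ≥0∞) / A * volume (Metric.closedBall (0 : Plane) (r + -(2 * c)))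
      ≤ m / A * ((latticePointsInBall b (r - c)).card * A) := by gcongr
    _ = (((latticePointsInBall b (r - c)).card * m : ℕ) : ℝ≥0∞) := by
        rw [mul_comm _ A, ← mul_assoc, ENNReal.div_mul_cancel hA0 hAt]
        push_cast
        ring
    _ ≤ _ := by
        have h2 := (encard_inter_biUnion_latticeCell b P m h (latticePointsInBall b (r - c))
          fun v hv => (mem_latticePointsInBall.1 hv).2).trans
          (Set.encard_le_encard (Set.inter_subset_inter_right P
            (t := Metric.closedBall (0 : Plane) r) ?_))
        · have h3 := ENat.toENNReal_le.2 h2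
          simpa using h3
        · refine Set.iUnion₂_subset fun v hv => ?_
          convert latticeCell_subset_closedBall hc (mem_latticePointsInBall.1 hv).1 using 2
          ring

/-- The cells at lattice points of the disk of radius `r` are disjoint and stay within radius `r +
c`, so comparing areas bounds their number. -/
theorem lowerDensity_span_le (b : Module.Basis (Fin 2) ℝ Plane) :
    lowerDensity (Submodule.span ℤ (Set.range b) : Set Plane) ≤
      (volume (ZSpan.fundamentalDomain b))⁻¹ := by
  obtain ⟨c, hc0, hc⟩ := exists_norm_le_fundamentalDomain b
  set A := volume (ZSpan.fundamentalDomain b) with hA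
  have hA0 : A ≠ 0 := volume_fundamentalDomain_pos b
  have hAt : A ≠ ⊤ := volume_fundamentalDomain_ne_top b
  have hlim : Tendsto (fun r : ℝ => A⁻¹ * ENNReal.ofReal (((r + c) / r) ^ 2))
      atTop (nhds A⁻¹) := by
    have := ENNReal.Tendsto.const_mul (a := A⁻¹) (tendsto_ofReal_ratio_sq c)
      (Or.inl one_ne_zero)
    simpa using this
  rw [← hlim.liminf_eq]
  refine liminf_le_liminf ?_
  filter_upwards [eventually_gt_atTop 0] with r hr0
  rw [← volume_closedBall_div hr0 (by linarith), densityOver, ← mul_div_assoc]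
  gcongr
  have h1 : (latticePointsInBall b r).card * A ≤
      volume (Metric.closedBall (0 : Plane) (r + c)) := by
    rw [← volume_biUnion_latticeCell]
    exact measure_mono (Set.iUnion₂_subset fun v hv =>
      latticeCell_subset_closedBall hc (mem_latticePointsInBall.1 hv).1)
  have h2 : (Submodule.span ℤ (Set.range b) : Set Plane) ∩ Metric.closedBall 0 r =
      (latticePointsInBall b r : Set Plane) := by
    ext v
    simp [mem_latticePointsInBall, and_comm]
  rw [h2, Set.encard_coe_eq_coe_finsetCard, ENat.toENNReal_coe, mul_comm,
    ← div_eq_mul_inv]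
  exact (ENNReal.le_div_iff_mul_le (Or.inl hA0) (Or.inl hAt)).2 h1

/-! ### Rectangles and lattices in coordinates -/

theorem mem_vadd_rect {w h : ℝ} {x p : Plane} :
    p ∈ x +ᵥ rect w h ↔ (x 0 ≤ p 0 ∧ p 0 ≤ x 0 + w) ∧ (x 1 ≤ p 1 ∧ p 1 ≤ x 1 + h) := by
  rw [Set.mem_vadd_set_iff_neg_vadd_mem]
  simp only [rect, Set.mem_ofPred_eq, vadd_eq_add, PiLp.add_apply, PiLp.neg_apply]
  constructor
  · rintro ⟨h1, h2, h3, h4⟩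
    refine ⟨⟨?_, ?_⟩, ?_, ?_⟩ <;> linarith
  · rintro ⟨⟨h1, h2⟩, h3, h4⟩
    refine ⟨?_, ?_, ?_, ?_⟩ <;> linarith

theorem linearIndependent_plane {a b c d : ℝ} (hdet : a * d - b * c ≠ 0) :
    LinearIndependent ℝ ![(!₂[a, b] : Plane), !₂[c, d]] := by
  rw [LinearIndependent.pair_iff]
  intro s t hst
  have h0 : s * a + t * c = 0 := by simpa using congrArg (fun v : Plane => v 0) hst
  have h1 : s * b + t * d = 0 := by simpa using congrArg (fun v : Plane => v 1) hst
  constructor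
  · refine (mul_eq_zero.1 (?_ : s * (a * d - b * c) = 0)).resolve_right hdet
    linear_combination d * h0 - c * h1
  · refine (mul_eq_zero.1 (?_ : t * (a * d - b * c) = 0)).resolve_right hdet
    linear_combination a * h1 - b * h0

/-- The basis of the plane with vectors `(a, b)` and `(c, d)`. -/
noncomputable def planeBasis {a b c d : ℝ} (hdet : a * d - b * c ≠ 0) :
    Module.Basis (Fin 2) ℝ Plane :=
  basisOfLinearIndependentOfCardEqFinrank (linearIndependent_plane hdet) (by simp)

theorem coe_planeBasis {a b c d : ℝ} (hdet : a * d - b * c ≠ 0) :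
    ⇑(planeBasis hdet) = ![(!₂[a, b] : Plane), !₂[c, d]] :=
  coe_basisOfLinearIndependentOfCardEqFinrank _ _

theorem volume_fundamentalDomain_planeBasis {a b c d : ℝ} (hdet : a * d - b * c ≠ 0) :
    volume (ZSpan.fundamentalDomain (planeBasis hdet)) = ENNReal.ofReal |a * d - b * c| := by
  rw [volume_fundamentalDomain_plane, coe_planeBasis]
  simp

theorem mem_span_planeBasis {a b c d : ℝ} (hdet : a * d - b * c ≠ 0) (i j : ℤ) :
    (!₂[i * a + j * c, i * b + j * d] : Plane) ∈
      Submodule.span ℤ (Set.range (planeBasis hdet)) := by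
  have h0 : (!₂[a, b] : Plane) ∈ Submodule.span ℤ (Set.range (planeBasis hdet)) :=
    Submodule.subset_span ⟨0, by simp [coe_planeBasis]⟩
  have h1 : (!₂[c, d] : Plane) ∈ Submodule.span ℤ (Set.range (planeBasis hdet)) :=
    Submodule.subset_span ⟨1, by simp [coe_planeBasis]⟩
  convert Submodule.add_mem _ (Submodule.smul_mem _ i h0) (Submodule.smul_mem _ j h1) using 1
  ext n
  fin_cases n <;> simp

/-- The lattice spanned by `(a, b)` and `(c, d)`, if piercing, bounds the per-point area. -/
theorem ofReal_det_le_areaL {w h a b c d : ℝ} (hdet : a * d - b * c ≠ 0)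
    (hrow : ∀ X Y : ℝ, ∃ i j : ℤ, (X ≤ i * a + j * c ∧ i * a + j * c ≤ X + w) ∧
      (Y ≤ i * b + j * d ∧ i * b + j * d ≤ Y + 1))
    (hcol : ∀ X Y : ℝ, ∃ i j : ℤ, (X ≤ i * a + j * c ∧ i * a + j * c ≤ X + 1) ∧
      (Y ≤ i * b + j * d ∧ i * b + j * d ≤ Y + h)) :
    ENNReal.ofReal |a * d - b * c| ≤ areaL w h := by
  rw [areaL, ENNReal.le_inv_iff_le_inv, ← volume_fundamentalDomain_planeBasis hdet]
  refine le_trans ?_ (lowerDensity_span_le _)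
  refine iInf₂_le_of_le _ ⟨Submodule.span ℤ (Set.range (planeBasis hdet)), inferInstance,
    inferInstance, rfl⟩ (iInf_le_of_le ?_ le_rfl)
  rintro S (rfl | rfl) x
  · obtain ⟨i, j, hij⟩ := hrow (x 0) (x 1)
    exact ⟨_, mem_span_planeBasis hdet i j, mem_vadd_rect.2 (by simpa using hij)⟩
  · obtain ⟨i, j, hij⟩ := hcol (x 0) (x 1)
    exact ⟨_, mem_span_planeBasis hdet i j, mem_vadd_rect.2 (by simpa using hij)⟩

/-! ### The piercing lattices -/

/-- A discrete intermediate value principle: the first value to reach `X` overshoots by at most one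
step. -/
theorem exists_int_mem_interval_of_step {f : ℤ → ℝ} {w : ℝ} (hstep : ∀ i, f (i + 1) ≤ f i + w)
    {X : ℝ} {i₀ i₁ : ℤ} (hle : i₀ ≤ i₁) (h₀ : f i₀ < X) (h₁ : X ≤ f i₁) :
    ∃ i, X ≤ f i ∧ f i ≤ X + w := by
  classical
  have hex : ∃ n : ℕ, X ≤ f (i₀ + n) := ⟨(i₁ - i₀).toNat, by
    rwa [Int.toNat_of_nonneg (by lia), add_sub_cancel]⟩
  obtain ⟨n, hn⟩ : ∃ n, Nat.find hex = n + 1 := Nat.exists_eq_succ_of_ne_zero fun h0 => by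
    have := Nat.find_spec hex
    rw [h0] at this
    simp only [Nat.cast_zero, add_zero] at this
    linarith
  have hlt := Nat.find_min hex (m := n) (by lia)
  have hspec := Nat.find_spec hex
  rw [hn] at hspec
  refine ⟨_, hspec, ?_⟩
  have := hstep (i₀ + n)
  push_cast [← add_assoc]
  linarith

/-- For each `i`, the choice `j = ⌊i * c - Y⌋` puts the point in the row. As `c ≤ 1`, this `j` grows
by at most 1 with `i`, so the abscissa advances by at most `1 + u ≤ w`. -/
theorem exists_lattice_mem_row {u c w : ℝ} (hc0 : 0 ≤ c) (hc1 : c ≤ 1) (hu : 0 ≤ u)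
    (hw : u + 1 ≤ w) (X Y : ℝ) : ∃ i j : ℤ, (X ≤ i + j * u ∧ i + j * u ≤ X + w) ∧
      (Y ≤ i * c - j ∧ i * c - j ≤ Y + 1) := by
  have hfl : ∀ i : ℤ, (⌊i * c - Y⌋ : ℝ) ≤ i * c - Y ∧ i * c - Y < ⌊i * c - Y⌋ + 1 :=
    fun i => ⟨Int.floor_le _, Int.lt_floor_add_one _⟩
  suffices hex : ∃ i : ℤ, X ≤ i + ⌊i * c - Y⌋ * u ∧ i + ⌊i * c - Y⌋ * u ≤ X + w by
    obtain ⟨i, hi⟩ := hex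
    refine ⟨i, ⌊i * c - Y⌋, hi, ?_, ?_⟩ <;> linarith [hfl i]
  -- The endpoints are crude: they only ensure that the abscissa is below `X` at one and at least
  -- `X` at the other.
  refine exists_int_mem_interval_of_step (f := fun i : ℤ => i + ⌊i * c - Y⌋ * u)
    (i₀ := -⌈|X| + |Y| * u + 1⌉) (i₁ := ⌈|X| + (|Y| + 1) * u⌉) ?_ ?_ ?_ ?_
  · intro i
    have : ⌊((i + 1 : ℤ) : ℝ) * c - Y⌋ ≤ ⌊i * c - Y⌋ + 1 := by
      rw [← Int.floor_add_one]
      refine Int.floor_le_floor ?_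
      push_cast
      linarith
    have h2 : (⌊((i + 1 : ℤ) : ℝ) * c - Y⌋ : ℝ) ≤ ⌊i * c - Y⌋ + 1 := by exact_mod_cast this
    have h3 := mul_le_mul_of_nonneg_right h2 hu
    simp only [Int.cast_add, Int.cast_one] at h3 ⊢
    linarith
  · have h1 : 0 ≤ ⌈|X| + |Y| * u + 1⌉ := Int.ceil_nonneg (by positivity)
    have h2 : 0 ≤ ⌈|X| + (|Y| + 1) * u⌉ := Int.ceil_nonneg (by positivity)
    lia
  · set n := ⌈|X| + |Y| * u + 1⌉ with hn
    have h1 : |X| + |Y| * u + 1 ≤ n := Int.le_ceil _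
    have hn0 : (0 : ℝ) ≤ n := le_trans (by positivity) h1
    have h2 : (⌊((-n : ℤ) : ℝ) * c - Y⌋ : ℝ) ≤ |Y| := by
      refine (hfl (-n)).1.trans ?_
      push_cast
      nlinarith [neg_abs_le Y]
    have h3 := mul_le_mul_of_nonneg_right h2 hu
    have h4 := neg_abs_le X
    simp only [Int.cast_neg] at h3 ⊢
    linarith
  · set n := ⌈|X| + (|Y| + 1) * u⌉ with hn
    have h1 : |X| + (|Y| + 1) * u ≤ n := Int.le_ceil _
    have hn0 : (0 : ℝ) ≤ n := le_trans (by positivity) h1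
    have h2 : -(|Y| + 1) ≤ (⌊(n : ℝ) * c - Y⌋ : ℝ) := by
      have := (hfl n).2
      nlinarith [le_abs_self Y]
    have h3 := mul_le_mul_of_nonneg_right h2 hu
    have h4 := le_abs_self X
    linarith

/-- With `n = -j`, the choice `i = ⌈X + n * u⌉` puts the point in the column. As `u ≤ K` with `K` an
integer, this `i` grows by at most `K`, so the ordinate advances by at most `K * c + 1 ≤ h`. -/
theorem exists_lattice_mem_column {u c h : ℝ} {K : ℕ} (hc0 : 0 ≤ c) (hc1 : c ≤ 1) (hu : 0 ≤ u)
    (huK : u ≤ K) (hh : K * c + 1 ≤ h) (X Y : ℝ) :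
    ∃ i j : ℤ, (X ≤ i + j * u ∧ i + j * u ≤ X + 1) ∧
      (Y ≤ i * c - j ∧ i * c - j ≤ Y + h) := by
  have hcl : ∀ n : ℤ, X + n * u ≤ (⌈X + n * u⌉ : ℝ) ∧ (⌈X + n * u⌉ : ℝ) < X + n * u + 1 :=
    fun n => ⟨Int.le_ceil _, Int.ceil_lt_add_one _⟩
  suffices hex : ∃ n : ℤ, Y ≤ ⌈X + n * u⌉ * c + n ∧ ⌈X + n * u⌉ * c + n ≤ Y + h by
    obtain ⟨n, hn⟩ := hex
    refine ⟨⌈X + n * u⌉, -n, ⟨?_, ?_⟩, ?_, ?_⟩ <;> push_cast <;> linarith [hcl n]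
  refine exists_int_mem_interval_of_step (f := fun n : ℤ => ⌈X + n * u⌉ * c + n)
    (i₀ := -⌈|X| + |Y| + 2⌉) (i₁ := ⌈|X| + |Y|⌉) ?_ ?_ ?_ ?_
  · intro n
    have : ⌈X + ((n + 1 : ℤ) : ℝ) * u⌉ ≤ ⌈X + n * u⌉ + K := by
      rw [← Int.ceil_add_natCast]
      refine Int.ceil_le_ceil ?_
      push_cast
      linarith
    have h2 : (⌈X + ((n + 1 : ℤ) : ℝ) * u⌉ : ℝ) ≤ ⌈X + n * u⌉ + K := by exact_mod_cast this
    have h3 := mul_le_mul_of_nonneg_right h2 hc0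
    simp only [Int.cast_add, Int.cast_one] at h3 ⊢
    linarith
  · have h1 : 0 ≤ ⌈|X| + |Y| + 2⌉ := Int.ceil_nonneg (by positivity)
    have h2 : 0 ≤ ⌈|X| + |Y|⌉ := Int.ceil_nonneg (by positivity)
    lia
  · set n := ⌈|X| + |Y| + 2⌉ with hn
    have h1 : |X| + |Y| + 2 ≤ n := Int.le_ceil _
    have hn0 : (0 : ℝ) ≤ n := le_trans (by positivity) h1
    have h2 : (⌈X + ((-n : ℤ) : ℝ) * u⌉ : ℝ) ≤ |X| + 1 := by
      refine (hcl (-n)).2.le.trans ?_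
      push_cast
      nlinarith [le_abs_self X]
    have h3 := mul_le_mul_of_nonneg_right h2 hc0
    have h4 := neg_abs_le Y
    have h5 : (|X| + 1) * c ≤ |X| + 1 := mul_le_of_le_one_right (by positivity) hc1
    simp only [Int.cast_neg] at h3 ⊢
    linarith
  · set n := ⌈|X| + |Y|⌉ with hn
    have h1 : |X| + |Y| ≤ n := Int.le_ceil _
    have hn0 : (0 : ℝ) ≤ n := le_trans (by positivity) h1
    have h2 : -|X| ≤ (⌈X + (n : ℝ) * u⌉ : ℝ) := by
      have := (hcl n).1
      nlinarith [neg_abs_le X]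
    have h3 := mul_le_mul_of_nonneg_right h2 hc0
    have h4 := le_abs_self Y
    have h5 : |X| * c ≤ |X| := mul_le_of_le_one_right (by positivity) hc1
    linarith

theorem ofReal_le_areaL {u c w h : ℝ} {K : ℕ} (hc0 : 0 ≤ c) (hc1 : c ≤ 1) (hu : 0 ≤ u)
    (hw : u + 1 ≤ w) (huK : u ≤ K) (hh : K * c + 1 ≤ h) :
    ENNReal.ofReal (1 + u * c) ≤ areaL w h := by
  have hpos : 0 < 1 + u * c := by positivity
  have habs : |(1 : ℝ) * (-1) - c * u| = 1 + u * c := by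
    rw [abs_of_neg (by linarith)]
    ring
  rw [← habs]
  refine ofReal_det_le_areaL (by linarith) (fun X Y => ?_) fun X Y => ?_
  · obtain ⟨i, j, hij⟩ := exists_lattice_mem_row hc0 hc1 hu hw X Y
    exact ⟨i, j, by simpa [sub_eq_add_neg] using hij⟩
  · obtain ⟨i, j, hij⟩ := exists_lattice_mem_column hc0 hc1 hu huK hh X Y
    exact ⟨i, j, by simpa [sub_eq_add_neg] using hij⟩

/-- The same lattice reflected in the diagonal, with basis `(c, 1)` and `(-1, u)`. -/
theorem ofReal_le_areaL_swap {u c w h : ℝ} {K : ℕ} (hc0 : 0 ≤ c) (hc1 : c ≤ 1) (hu : 0 ≤ u)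
    (hh : u + 1 ≤ h) (huK : u ≤ K) (hw : K * c + 1 ≤ w) :
    ENNReal.ofReal (1 + u * c) ≤ areaL w h := by
  have hpos : 0 < 1 + u * c := by positivity
  have habs : |c * u - 1 * (-1 : ℝ)| = 1 + u * c := by
    rw [abs_of_pos (by linarith)]
    ring
  rw [← habs]
  refine ofReal_det_le_areaL (by linarith) (fun X Y => ?_) fun X Y => ?_
  · obtain ⟨i, j, hij⟩ := exists_lattice_mem_column hc0 hc1 hu huK hw Y X
    exact ⟨i, j, by simpa [sub_eq_add_neg] using hij.symm⟩
  · obtain ⟨i, j, hij⟩ := exists_lattice_mem_row hc0 hc1 hu hh Y X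
    exact ⟨i, j, by simpa [sub_eq_add_neg] using hij.symm⟩

/-! ### Density bounds from counting in boxes -/

theorem mem_latticeCell_diagonal {α β : ℝ} (hdet : α * β - 0 * 0 ≠ 0) (hα : 0 < α) (hβ : 0 < β)
    {v z : Plane} (h0 : z 0 ∈ Set.Ico (v 0) (v 0 + α)) (h1 : z 1 ∈ Set.Ico (v 1) (v 1 + β)) :
    z ∈ latticeCell (planeBasis hdet) v := by
  have hz : z - v = ((z 0 - v 0) / α) • planeBasis hdet 0 + ((z 1 - v 1) / β) • planeBasis hdet 1 := by
    rw [coe_planeBasis]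
    ext n
    fin_cases n <;> simp [hα.ne', hβ.ne']
  change z - v ∈ ZSpan.fundamentalDomain _
  rw [ZSpan.mem_fundamentalDomain, hz]
  intro n
  simp only [map_add, map_smul, Module.Basis.repr_self]
  fin_cases n
  · have : 0 ≤ (z 0 - v 0) / α ∧ (z 0 - v 0) / α < 1 :=
      ⟨div_nonneg (by linarith [h0.1]) hα.le, (div_lt_one hα).2 (by linarith [h0.2])⟩
    simpa using this
  · have : 0 ≤ (z 1 - v 1) / β ∧ (z 1 - v 1) / β < 1 :=
      ⟨div_nonneg (by linarith [h1.1]) hβ.le, (div_lt_one hβ).2 (by linarith [h1.2])⟩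
    simpa using this

theorem ofReal_le_lowerDensity {P : Set Plane} {α β : ℝ} (hα : 0 < α) (hβ : 0 < β) (m : ℕ)
    (h : ∀ a b : ℝ, (m : ℕ∞) ≤
      {p ∈ P | p 0 ∈ Set.Ico a (a + α) ∧ p 1 ∈ Set.Ico b (b + β)}.encard)
    {c : ℝ} (hc : c ≤ m) : ENNReal.ofReal (c / (α * β)) ≤ lowerDensity P := by
  have hdet : α * β - 0 * 0 ≠ 0 := by
    have := mul_pos hα hβ
    linarith
  have h1 := div_volume_le_lowerDensity (planeBasis hdet) P m fun v =>
    (h (v 0) (v 1)).trans (Set.encard_le_encard fun z hz =>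
      ⟨hz.1, mem_latticeCell_diagonal hdet hα hβ hz.2.1 hz.2.2⟩)
  refine le_trans ?_ h1
  rw [volume_fundamentalDomain_planeBasis, mul_zero, sub_zero, abs_of_pos (mul_pos hα hβ),
    ENNReal.ofReal_div_of_pos (mul_pos hα hβ)]
  gcongr
  rw [← ENNReal.ofReal_natCast]
  exact ENNReal.ofReal_le_ofReal hc

/-- A closed rectangle fits in a half-open box with both sides longer by `ε`; then `ε` tends to 0.
-/
theorem ofReal_inv_le_lowerDensity_of_rect {P : Set Plane} {w h : ℝ} (hw : 0 < w) (hh : 0 < h)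
    (hP : ∀ X Y : ℝ, ∃ p ∈ P, (X ≤ p 0 ∧ p 0 ≤ X + w) ∧ (Y ≤ p 1 ∧ p 1 ≤ Y + h)) :
    ENNReal.ofReal (1 / (w * h)) ≤ lowerDensity P := by
  have hlim : Tendsto (fun ε : ℝ => ENNReal.ofReal (1 / ((w + ε) * (h + ε))))
      (nhdsWithin 0 (Set.Ioi 0)) (nhds (ENNReal.ofReal (1 / (w * h)))) := by
    refine ENNReal.tendsto_ofReal (tendsto_nhdsWithin_of_tendsto_nhds ?_)
    have hcont : ContinuousAt (fun ε : ℝ => 1 / ((w + ε) * (h + ε))) 0 :=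
      ContinuousAt.div (by fun_prop) (by fun_prop) (by simp [hw.ne', hh.ne'])
    simpa [ContinuousAt] using hcont
  refine le_of_tendsto hlim ?_
  filter_upwards [self_mem_nhdsWithin] with ε hε
  have hε : 0 < ε := hε
  refine ofReal_le_lowerDensity (m := 1) (by linarith) (by linarith) (fun a b => ?_) (by simp)
  obtain ⟨p, hpP, hp⟩ := hP a b
  rw [Nat.cast_one, Set.one_le_encard_iff_nonempty]
  exact ⟨p, hpP, ⟨hp.1.1, by linarith [hp.1.2]⟩, hp.2.1, by linarith [hp.2.2]⟩

/-! ### Locally finite sets and half-open rectangles -/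

theorem lowerDensity_eq_top {P : Set Plane} {R : ℝ}
    (h : (P ∩ Metric.closedBall 0 R).Infinite) : lowerDensity P = ⊤ := by
  refine top_le_iff.1 (le_liminf_of_le (by isBoundedDefault) ?_)
  filter_upwards [eventually_ge_atTop R] with r hr
  have : (P ∩ Metric.closedBall 0 r).Infinite :=
    h.mono (Set.inter_subset_inter_right _ (Metric.closedBall_subset_closedBall hr))
  rw [densityOver, this.encard_eq, ENat.toENNReal_top,
    ENNReal.top_div_of_ne_top measure_closedBall_lt_top.ne]

theorem finite_box {P : Set Plane} (hfin : ∀ R, (P ∩ Metric.closedBall 0 R).Finite)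
    (a a' b b' : ℝ) : {p ∈ P | p 0 ∈ Set.Icc a a' ∧ p 1 ∈ Set.Icc b b'}.Finite := by
  refine (hfin (max |a| |a'| + max |b| |b'|)).subset fun p hp => ⟨hp.1, ?_⟩
  have h0 : |p 0| ≤ max |a| |a'| := abs_le_max_abs_abs hp.2.1.1 hp.2.1.2
  have h1 : |p 1| ≤ max |b| |b'| := abs_le_max_abs_abs hp.2.2.1 hp.2.2.2
  rw [mem_closedBall_zero_iff, EuclideanSpace.norm_eq, Fin.sum_univ_two]
  refine Real.sqrt_le_iff.2 ⟨by positivity, ?_⟩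
  simp only [Real.norm_eq_abs]
  nlinarith [abs_nonneg (p 0), abs_nonneg (p 1)]

theorem eventually_add_lt_of_lt {a b : ℝ} (h : a < b) :
    ∀ᶠ δ in nhdsWithin (0 : ℝ) (Set.Ioi 0), a + δ < b := by
  filter_upwards [Ioo_mem_nhdsGT (sub_pos.2 h)] with δ hδ
  linarith [hδ.2]

/-- For locally finite sets, piercing closed rectangles implies piercing half-open ones. -/
theorem exists_mem_Ioc_Ico {P : Set Plane} {w h : ℝ}
    (hfin : ∀ R, (P ∩ Metric.closedBall 0 R).Finite)
    (hP : ∀ X Y : ℝ, ∃ p ∈ P, (X ≤ p 0 ∧ p 0 ≤ X + w) ∧ (Y ≤ p 1 ∧ p 1 ≤ Y + h)) (X Y : ℝ) :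
    ∃ p ∈ P, p 0 ∈ Set.Ioc X (X + w) ∧ p 1 ∈ Set.Ico Y (Y + h) := by
  -- Only finitely many points are near, so a small `δ` keeps those beyond the right or lower edge
  -- outside after the rectangle moves right and down by `δ`. The move itself excludes the left and
  -- upper edges.
  have hev : ∀ᶠ δ in nhdsWithin (0 : ℝ) (Set.Ioi 0),
      ∀ p ∈ {p ∈ P | p 0 ∈ Set.Icc X (X + w + 1) ∧ p 1 ∈ Set.Icc (Y - 1) (Y + h)},
        (X + w < p 0 → X + w + δ < p 0) ∧ (p 1 < Y → p 1 + δ < Y) := by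
    refine (finite_box hfin _ _ _ _).eventually_all.2 fun p _ => ?_
    simp only [eventually_and, eventually_imp_distrib_left]
    exact ⟨eventually_add_lt_of_lt, eventually_add_lt_of_lt⟩
  obtain ⟨δ, hδ, hδ01⟩ := (hev.and (Ioo_mem_nhdsGT one_pos)).exists
  obtain ⟨p, hpP, hp⟩ := hP (X + δ) (Y - δ)
  obtain ⟨h1, h2⟩ := hδ p ⟨hpP, ⟨by linarith [hδ01.1], by linarith [hδ01.2]⟩,
    by linarith [hδ01.2], by linarith [hδ01.1]⟩
  refine ⟨p, hpP, ⟨by linarith [hδ01.1], ?_⟩, ?_, by linarith [hδ01.1]⟩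
  · by_contra! hlt
    linarith [h1 hlt]
  · by_contra! hlt
    linarith [h2 hlt]

/-- Here a shift to the left suffices. The open right edge keeps a point `p` out of the column
ending at its own abscissa. -/
theorem exists_mem_Ico_Icc {P : Set Plane} {w h : ℝ}
    (hfin : ∀ R, (P ∩ Metric.closedBall 0 R).Finite)
    (hP : ∀ X Y : ℝ, ∃ p ∈ P, (X ≤ p 0 ∧ p 0 ≤ X + w) ∧ (Y ≤ p 1 ∧ p 1 ≤ Y + h)) (X Y : ℝ) :
    ∃ p ∈ P, p 0 ∈ Set.Ico X (X + w) ∧ p 1 ∈ Set.Icc Y (Y + h) := by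
  have hev : ∀ᶠ δ in nhdsWithin (0 : ℝ) (Set.Ioi 0),
      ∀ p ∈ {p ∈ P | p 0 ∈ Set.Icc (X - 1) (X + w) ∧ p 1 ∈ Set.Icc Y (Y + h)},
        (p 0 < X → p 0 + δ < X) := by
    refine (finite_box hfin _ _ _ _).eventually_all.2 fun p _ => ?_
    simp only [eventually_imp_distrib_left]
    exact eventually_add_lt_of_lt
  obtain ⟨δ, hδ, hδ01⟩ := (hev.and (Ioo_mem_nhdsGT one_pos)).exists
  obtain ⟨p, hpP, hp⟩ := hP (X - δ) Y
  have h1 := hδ p ⟨hpP, ⟨by linarith [hδ01.2], by linarith [hδ01.1]⟩, hp.2⟩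
  refine ⟨p, hpP, ⟨?_, by linarith [hδ01.1]⟩, hp.2⟩
  by_contra! hlt
  linarith [h1 hlt]

/-! ### Gap counting on the line -/

/-- The points of `S` preceded by a gap of length greater than one. -/
def afterLongGap {α : Type*} (f : α → ℝ) (S : Set α) : Set α :=
  {p ∈ S | ∀ q ∈ S, f q ∉ Set.Ico (f p - 1) (f p)}

theorem ncard_Ioc_add_le {α : Type*} {f : α → ℝ} {A : Set α}
    (hfin : ∀ u v, (A ∩ f ⁻¹' Set.Ioc u v).Finite) {a s s' : ℝ} (h1 : a ≤ s) (h2 : s ≤ s') :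
    (A ∩ f ⁻¹' Set.Ioc a s).ncard + (A ∩ f ⁻¹' Set.Ioc s s').ncard ≤
      (A ∩ f ⁻¹' Set.Ioc a s').ncard := by
  rw [← Set.ncard_union_eq ?_ (hfin _ _) (hfin _ _), ← Set.inter_union_distrib_left,
    ← Set.preimage_union, Set.Ioc_union_Ioc_eq_Ioc h1 h2]
  refine Set.disjoint_left.2 fun p hp hp' => ?_
  have := hp.2.2
  have := hp'.2.1
  linarith

/-- In a set on the line whose windows of length `k + x` contain `k` points each, the number of
points plus `x` times the number of long gaps is at least the length covered. -/
theorem length_le_ncard_add {α : Type*} {f : α → ℝ} {S : Set α}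
    (hfin : ∀ u v, (S ∩ f ⁻¹' Set.Ioc u v).Finite) {k : ℕ} (hk : 1 ≤ k) {x : ℝ} (hx : 0 ≤ x)
    (hS : ∀ s, k ≤ (S ∩ f ⁻¹' Set.Ioc s (s + (k + x))).ncard) (a : ℝ) {X : ℝ} (hX : 0 ≤ X) :
    X ≤ (S ∩ f ⁻¹' Set.Ioc a (a + X + (k + x))).ncard +
      x * (afterLongGap f S ∩ f ⁻¹' Set.Ioc a (a + X + (k + x))).ncard := by
  have hkr : (1 : ℝ) ≤ k := by exact_mod_cast hk
  have hsub : afterLongGap f S ⊆ S := Set.sep_subset _ _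
  have hfinB : ∀ u v, (afterLongGap f S ∩ f ⁻¹' Set.Ioc u v).Finite := fun u v =>
    (hfin u v).subset (Set.inter_subset_inter_left _ hsub)
  let F : ℝ → ℝ := fun s => (S ∩ f ⁻¹' Set.Ioc a s).ncard +
    x * (afterLongGap f S ∩ f ⁻¹' Set.Ioc a s).ncard
  have hFadd : ∀ s s', a ≤ s → s ≤ s' → F s + ((S ∩ f ⁻¹' Set.Ioc s s').ncard +
      x * (afterLongGap f S ∩ f ⁻¹' Set.Ioc s s').ncard) ≤ F s' := by
    intro s s' h1 h2
    have e1 : ((S ∩ f ⁻¹' Set.Ioc a s).ncard : ℝ) + (S ∩ f ⁻¹' Set.Ioc s s').ncard ≤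
      (S ∩ f ⁻¹' Set.Ioc a s').ncard := by exact_mod_cast ncard_Ioc_add_le hfin h1 h2
    have e2 : ((afterLongGap f S ∩ f ⁻¹' Set.Ioc a s).ncard : ℝ) +
        (afterLongGap f S ∩ f ⁻¹' Set.Ioc s s').ncard ≤
        (afterLongGap f S ∩ f ⁻¹' Set.Ioc a s').ncard := by
      exact_mod_cast ncard_Ioc_add_le hfinB h1 h2
    have e3 := mul_le_mul_of_nonneg_left e2 hx
    simp only [F]
    linarith
  have hFmono : ∀ s s', a ≤ s → s ≤ s' → F s ≤ F s' := fun s s' h1 h2 =>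
    le_trans (le_add_of_nonneg_right (by positivity)) (hFadd s s' h1 h2)
  -- The sweep: wherever `F` pays for the length covered so far, it pays up to some point further
  -- right, at most `k + x` away.
  have hstep : ∀ s, a ≤ s → s - a ≤ F s → ∃ s', s < s' ∧ s' ≤ s + (k + x) ∧ s' - a ≤ F s' := by
    intro s has hs
    have hne : (S ∩ f ⁻¹' Set.Ioc s (s + (k + x))).Nonempty :=
      Set.nonempty_of_ncard_ne_zero (by have := hS s; lia)
    obtain ⟨p, hp, hmin⟩ := Set.exists_min_image _ f (hfin _ _) hne
    rcases le_or_gt (f p) (s + 1) with hgap | hgap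
    · refine ⟨f p, hp.2.1, hp.2.2, ?_⟩
      have h1 : 1 ≤ (S ∩ f ⁻¹' Set.Ioc s (f p)).ncard :=
        (Set.ncard_pos (hfin _ _)).2 ⟨p, hp.1, hp.2.1, le_rfl⟩
      have h1' : (1 : ℝ) ≤ (S ∩ f ⁻¹' Set.Ioc s (f p)).ncard := by exact_mod_cast h1
      have h2 := hFadd s (f p) has hp.2.1.le
      have h3 : 0 ≤ x * ((afterLongGap f S ∩ f ⁻¹' Set.Ioc s (f p)).ncard : ℝ) := by positivity
      linarith
    -- The first point `p` after `s` follows a long gap. The whole window then contributes at least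
    -- `k` points and one long gap, which pays for its length `k + x`.
    · refine ⟨s + (k + x), by linarith, le_rfl, ?_⟩
      have hpB : p ∈ afterLongGap f S := by
        refine ⟨hp.1, fun q hq hq' => ?_⟩
        have := hmin q ⟨hq, by linarith [hq'.1], hq'.2.le.trans hp.2.2⟩
        linarith [hq'.2]
      have h1 : 1 ≤ (afterLongGap f S ∩ f ⁻¹' Set.Ioc s (s + (k + x))).ncard :=
        (Set.ncard_pos (hfinB _ _)).2 ⟨p, hpB, hp.2⟩
      have h1' : (1 : ℝ) ≤ (afterLongGap f S ∩ f ⁻¹' Set.Ioc s (s + (k + x))).ncard := by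
        exact_mod_cast h1
      have h2 := hFadd s (s + (k + x)) has (by linarith)
      have h3 : (k : ℝ) ≤ (S ∩ f ⁻¹' Set.Ioc s (s + (k + x))).ncard := by exact_mod_cast hS s
      have h4 := mul_le_mul_of_nonneg_left h1' hx
      linarith
  -- Steps may be arbitrarily short, so the sweep is concluded at a supremum, which belongs to `G`
  -- because `F` is monotone.
  let G : Set ℝ := {s | a ≤ s ∧ s ≤ a + X + (k + x) ∧ s - a ≤ F s}
  have haG : a ∈ G := ⟨le_rfl, by linarith, by simp only [F, sub_self]; positivity⟩
  have hbdd : BddAbove G := ⟨_, fun s hs => hs.2.1⟩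
  have hσG : sSup G ∈ G := by
    have h1 : a ≤ sSup G := le_csSup hbdd haG
    refine ⟨h1, csSup_le ⟨a, haG⟩ fun s hs => hs.2.1, ?_⟩
    rw [sub_le_iff_le_add]
    refine csSup_le ⟨a, haG⟩ fun s hs => ?_
    linarith [hs.2.2, hFmono s (sSup G) hs.1 (le_csSup hbdd hs)]
  have hle : X ≤ sSup G - a := by
    by_contra! hlt
    obtain ⟨s', h1, h2, h3⟩ := hstep _ hσG.1 hσG.2.2
    exact absurd (le_csSup hbdd (show s' ∈ G from ⟨hσG.1.trans h1.le, by linarith, h3⟩))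
      (not_le.2 h1)
  exact hle.trans (hσG.2.2.trans (hFmono _ _ hσG.1 hσG.2.1))

theorem exists_subset_Icc_of_sub_le {T : Set ℝ} {y : ℝ} (hT : BddBelow T)
    (h : ∀ s ∈ T, ∀ t ∈ T, t - s ≤ y) : ∃ α, T ⊆ Set.Icc α (α + y) := by
  rcases T.eq_empty_or_nonempty with rfl | hne
  · exact ⟨0, Set.empty_subset _⟩
  · refine ⟨sInf T, fun t ht => ⟨csInf_le hT ht, ?_⟩⟩
    rw [← sub_le_iff_le_add]
    exact le_csInf hne fun s hs => by linarith [h s hs t ht]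

/-! ### Averaging over horizontal strips -/

/-- The points of `P` in the horizontal strip of height `k` with lower edge at height `t`. -/
def strip (P : Set Plane) (k : ℕ) (t : ℝ) : Set Plane :=
  {p ∈ P | p 1 ∈ Set.Ico t (t + k)}

theorem finite_strip_inter {P : Set Plane} (hfin : ∀ R, (P ∩ Metric.closedBall 0 R).Finite)
    (k : ℕ) (t u v : ℝ) : (strip P k t ∩ (fun p : Plane => p 0) ⁻¹' Set.Ioc u v).Finite :=
  (finite_box hfin u v t (t + k)).subset fun _ hp =>
    ⟨hp.1.1, Set.Ioc_subset_Icc_self hp.2, Set.Ico_subset_Icc_self hp.1.2⟩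

/-- The strip is a stack of `k` half-open unit rows; each supplies a point, and disjoint rows supply
distinct points. -/
theorem le_ncard_strip_inter {P : Set Plane} (hfin : ∀ R, (P ∩ Metric.closedBall 0 R).Finite)
    {w : ℝ} (hP : ∀ X Y : ℝ, ∃ p ∈ P, p 0 ∈ Set.Ioc X (X + w) ∧ p 1 ∈ Set.Ico Y (Y + 1))
    (k : ℕ) (t s : ℝ) :
    k ≤ (strip P k t ∩ (fun p : Plane => p 0) ⁻¹' Set.Ioc s (s + w)).ncard := by
  classical
  choose g hgP hg0 hg1 using fun j : Fin k => hP s (t + (j : ℕ))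
  have hinj : Function.Injective g := by
    intro i j hij
    have hi := hg1 i
    have hj := hg1 j
    rw [hij] at hi
    have h1 : ((i : ℕ) : ℝ) < (j : ℕ) + 1 := by linarith [hi.1, hj.2]
    have h2 : ((j : ℕ) : ℝ) < (i : ℕ) + 1 := by linarith [hi.2, hj.1]
    have h1' : (i : ℕ) < j + 1 := by exact_mod_cast h1
    have h2' : (j : ℕ) < i + 1 := by exact_mod_cast h2
    exact Fin.ext (by lia)
  calc k = ((Finset.univ.image g : Finset Plane) : Set Plane).ncard := by
        rw [Set.ncard_coe_finset, Finset.card_image_of_injective _ hinj, Finset.card_univ,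
          Fintype.card_fin]
    _ ≤ _ := by
        refine Set.ncard_le_ncard ?_ (finite_strip_inter hfin k t _ _)
        simp only [Finset.coe_image, Finset.coe_univ, Set.image_univ]
        rintro _ ⟨j, rfl⟩
        have hjk : ((j : ℕ) : ℝ) + 1 ≤ k := by exact_mod_cast j.2
        have hj0 : (0 : ℝ) ≤ (j : ℕ) := by positivity
        exact ⟨⟨hgP j, by linarith [(hg1 j).1], by linarith [(hg1 j).2]⟩, hg0 j⟩

/-- If `p` follows a long gap at heights `s` and `t` with `t - s > y`, both strips contain `p`, so
they overlap and together cover heights `s` to `s + k + y`. The point piercing the unit-width column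
left of `p` over these heights then lies in one of the two gaps. -/
theorem exists_Icc_of_mem_afterLongGap {P : Set Plane} {k : ℕ} {y : ℝ}
    (hP : ∀ X Y : ℝ, ∃ p ∈ P, p 0 ∈ Set.Ico X (X + 1) ∧ p 1 ∈ Set.Icc Y (Y + (k + y)))
    (p : Plane) :
    ∃ α, ∀ t, p ∈ afterLongGap (fun p : Plane => p 0) (strip P k t) → t ∈ Set.Icc α (α + y) := by
  refine exists_subset_Icc_of_sub_le (T := {t | p ∈ afterLongGap (fun p : Plane => p 0) (strip P k t)})
    ⟨p 1 - k, fun t ht => by linarith [ht.1.2.2]⟩ fun s hs t ht => ?_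
  by_contra! hlt
  obtain ⟨q, hqP, hq0, hq1⟩ := hP (p 0 - 1) s
  rw [sub_add_cancel] at hq0
  rcases lt_or_ge (q 1) (s + k) with hqs | hqs
  · exact hs.2 q ⟨hqP, hq1.1, hqs⟩ hq0
  · exact ht.2 q ⟨hqP, by linarith [ht.1.2.1, hs.1.2.2], by linarith [hq1.2]⟩ hq0

theorem setIntegral_indicator_one_le {I A : Set ℝ} (hA : MeasurableSet A) {c : ℝ} (hc : 0 ≤ c)
    (h : volume A ≤ ENNReal.ofReal c) : ∫ t in I, A.indicator (fun _ => (1 : ℝ)) t ≤ c := by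
  rw [integral_indicator_const _ hA, smul_eq_mul, mul_one]
  exact ENNReal.toReal_le_of_le_ofReal hc ((Measure.restrict_apply_le _ _).trans h)

theorem integrableOn_indicator_one {I A : Set ℝ} (hA : MeasurableSet A) (hI : volume I ≠ ⊤) :
    IntegrableOn (A.indicator fun _ => (1 : ℝ)) I :=
  (integrableOn_const hI).indicator hA

/-- A locally finite set piercing the `(k + x) × 1` and `1 × (k + y)` rectangles has at least
`X * Y / (k + x * y)` points in a box slightly larger than `X × Y`. -/
theorem mul_le_mul_ncard_box {P : Set Plane} (hfin : ∀ R, (P ∩ Metric.closedBall 0 R).Finite)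
    {k : ℕ} (hk : 1 ≤ k) {x y : ℝ} (hx : 0 ≤ x) (hy : 0 ≤ y)
    (hrow : ∀ X Y : ℝ, ∃ p ∈ P, (X ≤ p 0 ∧ p 0 ≤ X + (k + x)) ∧ (Y ≤ p 1 ∧ p 1 ≤ Y + 1))
    (hcol : ∀ X Y : ℝ, ∃ p ∈ P, (X ≤ p 0 ∧ p 0 ≤ X + 1) ∧ (Y ≤ p 1 ∧ p 1 ≤ Y + (k + y)))
    (a b : ℝ) {X Y : ℝ} (hX : 0 ≤ X) (hY : 0 ≤ Y) :
    X * Y ≤ (k + x * y) *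
      {p ∈ P | p 0 ∈ Set.Icc a (a + X + (k + x)) ∧ p 1 ∈ Set.Icc b (b + Y + k)}.ncard := by
  classical
  have hQfin := finite_box hfin a (a + X + (k + x)) b (b + Y + k)
  set Q := hQfin.toFinset with hQ
  choose α hα using exists_Icc_of_mem_afterLongGap (exists_mem_Ico_Icc hfin hcol)
  -- The charge to `p` at height `t`: 1 if `p` is in the strip, which means `p 1 - k < t ≤ p 1`,
  -- plus `x` on an interval containing every `t` at which `p` follows a long gap. Its integral is
  -- at most `k + x * y`.
  let g : Plane → ℝ → ℝ := fun p t => (Set.Ioc (p 1 - k) (p 1)).indicator (fun _ => 1) t +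
    x * (Set.Icc (α p) (α p + y)).indicator (fun _ => 1) t
  have hmem : ∀ t ∈ Set.Icc b (b + Y),
      ∀ p ∈ strip P k t ∩ (fun p : Plane => p 0) ⁻¹' Set.Ioc a (a + X + (k + x)), p ∈ Q := by
    intro t ht p hp
    refine hQfin.mem_toFinset.2 ⟨hp.1.1, Set.Ioc_subset_Icc_self hp.2, ?_, ?_⟩
    · linarith [hp.1.2.1, ht.1]
    · linarith [hp.1.2.2, ht.2]
  have hcard : ∀ (A : Set Plane) (B : Plane → Set ℝ) (t : ℝ), (∀ p ∈ A, p ∈ Q ∧ t ∈ B p) →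
      (A.ncard : ℝ) ≤ ∑ p ∈ Q, (B p).indicator (fun _ => 1) t := by
    intro A B t h
    have h1 : A.ncard ≤ (Q.filter fun p => t ∈ B p).card := by
      rw [← Set.ncard_coe_finset]
      exact Set.ncard_le_ncard (fun p hp => by simpa using h p hp) (Finset.finite_toSet _)
    calc (A.ncard : ℝ) ≤ (Q.filter fun p => t ∈ B p).card := by exact_mod_cast h1
      _ = _ := by simp [Set.indicator_apply, Finset.sum_boole]
  have hpt : ∀ t ∈ Set.Icc b (b + Y), X ≤ ∑ p ∈ Q, g p t := by
    intro t ht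
    refine (length_le_ncard_add (finite_strip_inter hfin k t) hk hx
      (le_ncard_strip_inter hfin (exists_mem_Ioc_Ico hfin hrow) k t) a hX).trans ?_
    simp only [g, Finset.sum_add_distrib, ← Finset.mul_sum]
    refine add_le_add (hcard _ _ t fun p hp => ⟨hmem t ht p hp, ?_, hp.1.2.1⟩)
      (mul_le_mul_of_nonneg_left (hcard _ _ t fun p hp => ⟨hmem t ht p ⟨hp.1.1, hp.2⟩,
        hα p t hp.1⟩) hx)
    linarith [hp.1.2.2]
  have hItop : volume (Set.Icc b (b + Y)) ≠ ⊤ := measure_Icc_lt_top.ne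
  have hint : ∀ p, IntegrableOn (g p) (Set.Icc b (b + Y)) := fun p =>
    (integrableOn_indicator_one measurableSet_Ioc hItop).add
      ((integrableOn_indicator_one measurableSet_Icc hItop).const_mul x)
  have hgle : ∀ p, ∫ t in Set.Icc b (b + Y), g p t ≤ k + x * y := by
    intro p
    rw [integral_add (integrableOn_indicator_one measurableSet_Ioc hItop)
      ((integrableOn_indicator_one measurableSet_Icc hItop).const_mul x), integral_const_mul]
    refine add_le_add (setIntegral_indicator_one_le measurableSet_Ioc (by positivity) ?_)
      (mul_le_mul_of_nonneg_left
        (setIntegral_indicator_one_le measurableSet_Icc hy ?_) hx)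
    · simp
    · simp
  calc X * Y = ∫ _ in Set.Icc b (b + Y), X := by
        simp [measureReal_def, hY, mul_comm]
    _ ≤ ∫ t in Set.Icc b (b + Y), ∑ p ∈ Q, g p t :=
        setIntegral_mono_on (integrableOn_const hItop) (integrable_finsetSum _ fun p _ => hint p)
          measurableSet_Icc hpt
    _ = ∑ p ∈ Q, ∫ t in Set.Icc b (b + Y), g p t := integral_finsetSum _ fun p _ => hint p
    _ ≤ ∑ _p ∈ Q, (k + x * y) := Finset.sum_le_sum fun p _ => hgle p
    _ = _ := by
        rw [Finset.sum_const, nsmul_eq_mul, mul_comm, Set.ncard_eq_toFinset_card _ hQfin]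

theorem tendsto_sq_div_mul_add (A c d : ℝ) :
    Tendsto (fun M : ℝ => M * M / A / ((M + c) * (M + d))) atTop (nhds (1 / A)) := by
  have h : Tendsto (fun M : ℝ => 1 / A / ((1 + c * M⁻¹) * (1 + d * M⁻¹))) atTop
      (nhds (1 / A / ((1 + c * 0) * (1 + d * 0)))) :=
    tendsto_const_nhds.div (((tendsto_inv_atTop_zero.const_mul c).const_add 1).mul
      ((tendsto_inv_atTop_zero.const_mul d).const_add 1)) (by simp)
  rw [mul_zero, mul_zero, add_zero, mul_one, div_one] at h
  refine h.congr' ?_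
  filter_upwards [eventually_gt_atTop 0] with M hM
  rw [show M + c = M * (1 + c * M⁻¹) by field_simp, show M + d = M * (1 + d * M⁻¹) by field_simp,
    show M * (1 + c * M⁻¹) * (M * (1 + d * M⁻¹)) =
      (M * M) * ((1 + c * M⁻¹) * (1 + d * M⁻¹)) by ring,
    show M * M / A = (M * M) * (1 / A) by ring, mul_div_mul_left _ _ (by positivity)]

/-- The density of a set piercing the `(k + x) × 1` and `1 × (k + y)` rectangles is at least
`1 / (k + x * y)`. -/
theorem ofReal_inv_le_lowerDensity {P : Set Plane} {k : ℕ} (hk : 1 ≤ k) {x y : ℝ} (hx : 0 ≤ x)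
    (hy : 0 ≤ y)
    (hrow : ∀ X Y : ℝ, ∃ p ∈ P, (X ≤ p 0 ∧ p 0 ≤ X + (k + x)) ∧ (Y ≤ p 1 ∧ p 1 ≤ Y + 1))
    (hcol : ∀ X Y : ℝ, ∃ p ∈ P, (X ≤ p 0 ∧ p 0 ≤ X + 1) ∧ (Y ≤ p 1 ∧ p 1 ≤ Y + (k + y))) :
    ENNReal.ofReal (1 / (k + x * y)) ≤ lowerDensity P := by
  by_cases hfin : ∀ R, (P ∩ Metric.closedBall 0 R).Finite
  swap
  · obtain ⟨R, hR⟩ := not_forall.1 hfin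
    rw [lowerDensity_eq_top hR]
    exact le_top
  have hkr : (1 : ℝ) ≤ k := by exact_mod_cast hk
  have hA : 0 < k + x * y := by positivity
  -- The sides are `M` plus a bounded margin: `k + x` and `k` from the box estimate, and 1 more to
  -- pass from closed to half-open boxes. The margins vanish in the limit.
  refine le_of_tendsto (ENNReal.tendsto_ofReal
    (tendsto_sq_div_mul_add (k + x * y) (k + x + 1) (k + 1))) ?_
  filter_upwards [eventually_gt_atTop 0] with M hM
  refine ofReal_le_lowerDensity (m := ⌈M * M / (k + x * y)⌉₊) (by positivity) (by positivity)
    (fun a b => ?_) (Nat.le_ceil _)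
  have h1 := mul_le_mul_ncard_box hfin hk hx hy hrow hcol a b hM.le hM.le
  have hbox := finite_box hfin a (a + M + (k + x)) b (b + M + k)
  have h2 : ⌈M * M / (k + x * y)⌉₊ ≤
      {p ∈ P | p 0 ∈ Set.Icc a (a + M + (k + x)) ∧ p 1 ∈ Set.Icc b (b + M + k)}.ncard := by
    rw [Nat.ceil_le, div_le_iff₀' hA]
    exact h1
  calc ((⌈M * M / (k + x * y)⌉₊ : ℕ) : ℕ∞) ≤
      {p ∈ P | p 0 ∈ Set.Icc a (a + M + (k + x)) ∧ p 1 ∈ Set.Icc b (b + M + k)}.encard := by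
        rw [← hbox.cast_ncard_eq]
        exact_mod_cast h2
    _ ≤ {p ∈ P | p 0 ∈ Set.Ico a (a + (M + (k + x + 1))) ∧
        p 1 ∈ Set.Ico b (b + (M + (k + 1)))}.encard :=
      Set.encard_le_encard fun p hp => ⟨hp.1, ⟨hp.2.1.1, by linarith [hp.2.1.2]⟩,
        hp.2.2.1, by linarith [hp.2.2.2]⟩

/-! ### Bounds on the per-point areas -/

theorem IsPiercing.exists_mem_row {w h : ℝ} {P : Set Plane} (hP : IsPiercing (rectPair w h) P)
    (X Y : ℝ) : ∃ p ∈ P, (X ≤ p 0 ∧ p 0 ≤ X + w) ∧ (Y ≤ p 1 ∧ p 1 ≤ Y + 1) := by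
  obtain ⟨p, hpP, hp⟩ := hP (rect w 1) (by simp [rectPair]) !₂[X, Y]
  exact ⟨p, hpP, by simpa using mem_vadd_rect.1 hp⟩

theorem IsPiercing.exists_mem_column {w h : ℝ} {P : Set Plane} (hP : IsPiercing (rectPair w h) P)
    (X Y : ℝ) : ∃ p ∈ P, (X ≤ p 0 ∧ p 0 ≤ X + 1) ∧ (Y ≤ p 1 ∧ p 1 ≤ Y + h) := by
  obtain ⟨p, hpP, hp⟩ := hP (rect 1 h) (by simp [rectPair]) !₂[X, Y]
  exact ⟨p, hpP, by simpa using mem_vadd_rect.1 hp⟩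

theorem areaT_le_ofReal {w h A : ℝ} (hA : 0 < A)
    (hP : ∀ P, IsPiercing (rectPair w h) P → ENNReal.ofReal (1 / A) ≤ lowerDensity P) :
    areaT w h ≤ ENNReal.ofReal A := by
  rw [areaT, ENNReal.inv_le_iff_inv_le, ← ENNReal.ofReal_inv_of_pos hA, ← one_div]
  exact le_iInf₂ hP

theorem areaT_le_min {w h : ℝ} (hw : 1 ≤ w) (hh : 1 ≤ h) :
    areaT w h ≤ ENNReal.ofReal (min w h) := by
  rcases min_choice w h with hmin | hmin <;> rw [hmin]
  · refine areaT_le_ofReal (by linarith) fun P hP => ?_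
    simpa using ofReal_inv_le_lowerDensity_of_rect (by linarith) one_pos hP.exists_mem_row
  · refine areaT_le_ofReal (by linarith) fun P hP => ?_
    simpa using ofReal_inv_le_lowerDensity_of_rect one_pos (by linarith) hP.exists_mem_column

theorem areaT_le_add_mul {k : ℕ} (hk : 1 ≤ k) {x y : ℝ} (hx : 0 ≤ x) (hy : 0 ≤ y) :
    areaT (k + x) (k + y) ≤ ENNReal.ofReal (k + x * y) := by
  have hkr : (1 : ℝ) ≤ k := by exact_mod_cast hk
  exact areaT_le_ofReal (by positivity) fun P hP =>
    ofReal_inv_le_lowerDensity hk hx hy hP.exists_mem_row hP.exists_mem_column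

theorem areaL_le_areaT (w h : ℝ) : areaL w h ≤ areaT w h := by
  rw [areaL, areaT, ENNReal.inv_le_inv]
  exact iInf_mono fun P => le_iInf fun _ => le_rfl

theorem ofReal_min_le_areaL_of_floor_ne {w h : ℝ} (hw : 1 ≤ w) (hh : 1 ≤ h) (hne : ⌊w⌋ ≠ ⌊h⌋) :
    ENNReal.ofReal (min w h) ≤ areaL w h := by
  -- With `c = 1` the covolume is the shorter length `u`. The integer `K = ⌊u⌋` is admissible since
  -- `⌊u⌋ + 1 ≤ ⌊v⌋ ≤ v`.
  have key : ∀ {u v : ℝ}, 1 ≤ u → ⌊u⌋ < ⌊v⌋ →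
      ∃ K : ℕ, u - 1 ≤ K ∧ (K : ℝ) * 1 + 1 ≤ v ∧ u ≤ v := by
    intro u v hu huv
    have h0 : 0 ≤ ⌊u⌋ := Int.floor_nonneg.2 (by linarith)
    obtain ⟨K, hK⟩ := Int.eq_ofNat_of_zero_le h0
    have h1 : u < (K : ℝ) + 1 := by
      have := Int.lt_floor_add_one u
      rw [hK] at this
      exact_mod_cast this
    have h2 : (K : ℝ) + 1 ≤ v := by
      have h3 : ((⌊u⌋ + 1 : ℤ) : ℝ) ≤ v := Int.le_floor.1 huv
      rw [hK] at h3
      exact_mod_cast h3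
    exact ⟨K, by linarith, by linarith, by linarith⟩
  rcases lt_or_gt_of_ne hne with hlt | hlt
  · obtain ⟨K, h1, h2, h3⟩ := key hw hlt
    have := ofReal_le_areaL (w := w) zero_le_one le_rfl (sub_nonneg.2 hw) (by linarith) h1 h2
    rw [mul_one, add_sub_cancel] at this
    rwa [min_eq_left h3]
  · obtain ⟨K, h1, h2, h3⟩ := key hh hlt
    have := ofReal_le_areaL_swap (h := h) zero_le_one le_rfl (sub_nonneg.2 hh) (by linarith) h1 h2
    rw [mul_one, add_sub_cancel] at this
    rwa [min_eq_right h3]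

theorem ofReal_natCast_le_areaL {k : ℕ} (hk : 1 ≤ k) {w h : ℝ} (hw : k ≤ w) (hh : k ≤ h) :
    ENNReal.ofReal k ≤ areaL w h := by
  obtain ⟨K, rfl⟩ := Nat.exists_eq_add_of_le hk
  push_cast at hw hh ⊢
  -- After the substitution `k = 1 + K`, the lattice has `u = k - 1` and `c = 1`, hence covolume
  -- `k`.
  simpa using ofReal_le_areaL (u := K) (c := 1) (K := K) (w := w) (h := h) zero_le_one le_rfl
    (by positivity) (by linarith) le_rfl (by linarith)

/-- Take `u = w - 1` and `K = k`; then `c = (h - 1) / k` is the largest slope allowed by `K * c + 1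
≤ h`, and the stated quantity is the covolume `1 + u * c`. -/
theorem ofReal_add_mul_sub_le_areaL {k : ℕ} (hk : 1 ≤ k) {x y : ℝ} (hx : 0 ≤ x) (hx1 : x < 1)
    (hy : 0 ≤ y) (hy1 : y < 1) :
    ENNReal.ofReal (k + x * y - ((k - 1 : ℝ) / k) * (1 - x) * (1 - y)) ≤
      areaL (k + x) (k + y) := by
  have hkr : (1 : ℝ) ≤ k := by exact_mod_cast hk
  have hk0 : (k : ℝ) ≠ 0 := by positivity
  have heq : k + x * y - ((k - 1 : ℝ) / k) * (1 - x) * (1 - y) =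
      1 + (k + x - 1) * ((k + y - 1) / k) := by
    field_simp
    ring
  rw [heq]
  refine ofReal_le_areaL (K := k) (div_nonneg (by linarith) (by positivity))
    ((div_le_one (by positivity)).2 (by linarith)) (by linarith) (by linarith) (by linarith) ?_
  rw [mul_div_cancel₀ _ hk0]
  linarith

theorem max_eq_add_mul_iff {k : ℕ} (hk : 1 ≤ k) {x y : ℝ} (hx : 0 ≤ x) (hx1 : x < 1)
    (hy : 0 ≤ y) (hy1 : y < 1) :
    max (k : ℝ) (k + x * y - ((k - 1 : ℝ) / k) * (1 - x) * (1 - y)) = k + x * y ↔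
      k = 1 ∨ x = 0 ∨ y = 0 := by
  have hkr : (1 : ℝ) ≤ k := by exact_mod_cast hk
  have hxy : 0 ≤ x * y := mul_nonneg hx hy
  have hnonneg : 0 ≤ ((k - 1 : ℝ) / k) * (1 - x) * (1 - y) :=
    mul_nonneg (mul_nonneg (div_nonneg (by linarith) (by linarith)) (by linarith)) (by linarith)
  constructor
  · intro h
    rcases max_choice (k : ℝ) (k + x * y - ((k - 1 : ℝ) / k) * (1 - x) * (1 - y)) with h1 | h1
    · rw [h1] at h
      exact Or.inr (mul_eq_zero.1 (by linarith))
    · rw [h1] at h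
      have h2 : ((k - 1 : ℝ) / k) * (1 - x) * (1 - y) = 0 := by linarith
      have h3 : (k - 1 : ℝ) / k = 0 := by
        refine (mul_eq_zero.1 ((mul_eq_zero.1 h2).resolve_right ?_)).resolve_right ?_ <;>
          linarith
      have h4 : (k : ℝ) = 1 := by
        rcases div_eq_zero_iff.1 h3 with h5 | h5 <;> linarith
      exact Or.inl (by exact_mod_cast h4)
  · rintro (rfl | h | h)
    · simp [hxy]
    · have hz : x * y = 0 := by rw [h, zero_mul]
      rw [hz, add_zero]
      exact max_eq_left (by linarith)
    · have hz : x * y = 0 := by rw [h, mul_zero]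
      rw [hz, add_zero]
      exact max_eq_left (by linarith)

theorem theorem1 (w h : ℝ) (hw : 1 ≤ w) (hh : 1 ≤ h) :
    (⌊w⌋ ≠ ⌊h⌋ →
      areaT w h = ENNReal.ofReal (min w h) ∧ areaL w h = ENNReal.ofReal (min w h)) ∧
    (∀ (k : ℕ) (x y : ℝ), ⌊w⌋ = (k : ℤ) → ⌊h⌋ = (k : ℤ) → w = k + x → h = k + y →
      (ENNReal.ofReal (max (k : ℝ) (k + x * y - ((k - 1 : ℝ) / k) * (1 - x) * (1 - y)))
          ≤ areaL w h ∧
        areaL w h ≤ areaT w h ∧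
        areaT w h ≤ ENNReal.ofReal (k + x * y)) ∧
      (max (k : ℝ) (k + x * y - ((k - 1 : ℝ) / k) * (1 - x) * (1 - y)) = k + x * y ↔
        k = 1 ∨ x = 0 ∨ y = 0) ∧
      (k = 1 →
        areaL w h = ENNReal.ofReal (k + x * y) ∧ areaT w h = ENNReal.ofReal (k + x * y)) ∧
      (x = 0 ∨ y = 0 →
        areaL w h = ENNReal.ofReal (min w h) ∧ areaT w h = ENNReal.ofReal (min w h) ∧
        min w h = k)) := by
  refine ⟨fun hne => ?_, fun k x y hwk hhk hwx hhy => ?_⟩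
  · have hL := ofReal_min_le_areaL_of_floor_ne hw hh hne
    have hT := areaT_le_min hw hh
    have hLT := areaL_le_areaT w h
    exact ⟨le_antisymm hT (hL.trans hLT), le_antisymm (hLT.trans hT) hL⟩
  · have hk : 1 ≤ k := by
      have : (1 : ℤ) ≤ ⌊w⌋ := Int.le_floor.2 (by exact_mod_cast hw)
      lia
    obtain ⟨hw1, hw2⟩ := Int.floor_eq_iff.1 hwk
    obtain ⟨hh1, hh2⟩ := Int.floor_eq_iff.1 hhk
    push_cast at hw1 hw2 hh1 hh2
    have hx : 0 ≤ x := by linarith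
    have hx1 : x < 1 := by linarith
    have hy : 0 ≤ y := by linarith
    have hy1 : y < 1 := by linarith
    have hL : ENNReal.ofReal (max (k : ℝ)
        (k + x * y - ((k - 1 : ℝ) / k) * (1 - x) * (1 - y))) ≤ areaL w h := by
      rcases max_choice (k : ℝ) (k + x * y - ((k - 1 : ℝ) / k) * (1 - x) * (1 - y))
        with h1 | h1 <;> rw [h1]
      · exact ofReal_natCast_le_areaL hk hw1 hh1
      · rw [hwx, hhy]
        exact ofReal_add_mul_sub_le_areaL hk hx hx1 hy hy1
    have hT : areaT w h ≤ ENNReal.ofReal (k + x * y) := by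
      rw [hwx, hhy]
      exact areaT_le_add_mul hk hx hy
    have hLT := areaL_le_areaT w h
    have hiff := max_eq_add_mul_iff hk hx hx1 hy hy1
    have heq : k = 1 ∨ x = 0 ∨ y = 0 →
        areaL w h = ENNReal.ofReal (k + x * y) ∧ areaT w h = ENNReal.ofReal (k + x * y) := by
      intro hc
      rw [hiff.2 hc] at hL
      exact ⟨le_antisymm (hLT.trans hT) hL, le_antisymm hT (hL.trans hLT)⟩
    refine ⟨⟨hL, hLT, hT⟩, hiff, fun h1 => heq (Or.inl h1), fun h0 => ?_⟩
    have hmin : min w h = k := by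
      rcases h0 with h0 | h0
      · rw [min_eq_left (by linarith)]
        linarith
      · rw [min_eq_right (by linarith)]
        linarith
    have hxy : x * y = 0 := mul_eq_zero.2 h0
    have := heq (Or.inr h0)
    rw [hxy, add_zero] at this
    rw [hmin]
    exact ⟨this.1, this.2, rfl⟩
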